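/- Let $N\ge 1$ be an integer, $s\in(0,1)$ and $m>0$. Let $K_\nu$ denote the modified Bessel function of the second kind of order $\nu$, that is $K_\nu(r)=\int_0^\infty e^{-r\cosh t}\cosh(\nu t)\,dt$ for $r>0$. For a real-valued function $u$ in the Sobolev space $H^s(\mathbb R^N)$, let $(-\Delta+m^2)^{s/2}u$ be the function in $L^2(\mathbb R^N)$ whose (unitary) Fourier transform is $(|\xi|^2+m^2)^{s/2}\,\widehat u(\xi)$. Then for every real-valued $u\in H^s(\mathbb R^N)$ the double integral below converges and $$ \int_{\mathbb R^N}\Big[\big|(-\Delta+m^2)^{s/2}u\big|^2-m^{2s}u^2\Big]\,dx =\frac{c_{N,s}}{2}\,m^{\frac{N+2s}{2}}\int_{\mathbb R^{2N}}\frac{(u(x)-u(y))^2}{|x-y|^{\frac{N+2s}{2}}}\,K_{\frac{N+2s}{2}}(m|x-y|)\,dx\,dy, $$ where $$ c_{N,s}=\frac{2^{-\frac{N+2s}{2}+1}}{\Gamma\big(\frac{N+2s}{2}\big)}\left(\int_{\mathbb R^N}\frac{1-\cos(\xi_1)}{|\xi|^{N+2s}}\,d\xi\right)^{-1} =\frac{2^{-\frac{N+2s}{2}+1}}{\Gamma\big(\frac{N+2s}{2}\big)}\,\pi^{-\frac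 N2}\,2^{2s}\,\frac{\Gamma\big(\frac{N+2s}{2}\big)}{\Gamma(2-s)}\,s(1-s), $$ the integral defining $c_{N,s}$ being convergent. -/

import Mathlib

open MeasureTheory Real
open scoped SchwartzMap ENNReal

noncomputable section

/-- The modified Bessel function of the second kind `K_ν(r)`, `r > 0`, through its classical
integral representation `K_ν(r) = ∫₀^∞ exp(-r cosh t) cosh(ν t) dt`. -/
def besselK (ν r : ℝ) : ℝ :=
  ∫ t in Set.Ioi (0 : ℝ), exp (-r * cosh t) * cosh (ν * t)

/-- The tempered distribution given by a real-valued square-integrable function. -/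
def l2Distribution {N : ℕ} (u : EuclideanSpace ℝ (Fin N) → ℝ) (hu : MemLp u 2 volume) :
    𝓢'(EuclideanSpace ℝ (Fin N), ℂ) :=
  ((hu.ofReal (K := ℂ)).toLp (fun x => (u x : ℂ)) : Lp ℂ 2 volume)

/-- The power `(-Δ + m²)^σ` for `m > 0`, acting on tempered distributions as a Fourier multiplier.
Mathlib's Fourier transform has the kernel `exp(-2πi⟨x, ξ⟩)`, so that `-Δ + m²` has the symbol
`(2π‖ξ‖)² + m²`. -/
def relativisticPow (N : ℕ) (m σ : ℝ) :
    𝓢'(EuclideanSpace ℝ (Fin N), ℂ) →L[ℂ] 𝓢'(EuclideanSpace ℝ (Fin N), ℂ) :=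
  TemperedDistribution.fourierMultiplierCLM ℂ
    (fun ξ => ((((2 * π * ‖ξ‖) ^ 2 + m ^ 2) ^ σ : ℝ) : ℂ))

/-- The function `(1 - cos ξ₁) / |ξ|^(N + 2s)` on `ℝ^N`. -/
def cosineKernel (N : ℕ) [NeZero N] (s : ℝ) (ξ : EuclideanSpace ℝ (Fin N)) : ℝ :=
  (1 - cos (ξ 0)) / ‖ξ‖ ^ ((N : ℝ) + 2 * s)

/-- The constant `c_{N,s}`, defined through the integral of `(1 - cos ξ₁) / |ξ|^(N + 2s)`. -/
def relativisticConst (N : ℕ) [NeZero N] (s : ℝ) : ℝ :=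
  (2 : ℝ) ^ (-(((N : ℝ) + 2 * s) / 2) + 1) / Gamma (((N : ℝ) + 2 * s) / 2) *
    (∫ ξ : EuclideanSpace ℝ (Fin N), cosineKernel N s ξ)⁻¹

/-- The integrand `(u(x) - u(y))² |x - y|^(-(N + 2s)/2) K_{(N + 2s)/2}(m |x - y|)`. -/
def relativisticIntegrand {N : ℕ} (m s : ℝ) (u : EuclideanSpace ℝ (Fin N) → ℝ)
    (p : EuclideanSpace ℝ (Fin N) × EuclideanSpace ℝ (Fin N)) : ℝ :=
  (u p.1 - u p.2) ^ 2 / ‖p.1 - p.2‖ ^ (((N : ℝ) + 2 * s) / 2) *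
    besselK (((N : ℝ) + 2 * s) / 2) (m * ‖p.1 - p.2‖)

end

/-! Both sides are quadratic forms diagonalised by the Fourier transform. Setting h = x - y and
applying Plancherel to u(· + h) - u turns a double integral with kernel k(|x - y|) into 2 ∫ |û(ξ)|²
∫ (1 - cos(2πξ·h)) k(|h|) dh dξ (`lintegral_enorm_sub_sq_mul_kernel`), so only the inner integral
has to be computed.

The kernel is a mixture of Gaussians: with ν = N/2 + s, the integral of t^(-ν-1) exp(-bt - r²/(4t))
over t > 0 is a multiple of r^(-ν) K_ν(mr) for b = m², and of r^(-2ν) for b = 0. Integrating each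
Gaussian against 1 - cos(η·h), then integrating in t, gives a multiple of (|η|² + b)^s - b^s
(`lintegral_one_sub_cos_mul_subordinatedKernel`). The case b = m² yields the energy identity; the
case b = 0 with η a unit vector evaluates the integral defining c_{N,s}. The same factor appears in
both and cancels.

These interchanges are made for nonnegative integrands with values in `ℝ≥0∞`; convergence is then
read off from the finite value of the other side. -/

noncomputable section

/-! ### Bessel and power kernels as mixtures of Gaussians -/

/-- The integral of `t ^ (-ν - 1) * exp (-b t - r² / (4 t))` over the positive half-line. -/
def subordinatedKernel (b ν r : ℝ) : ℝ≥0∞ :=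
  ∫⁻ t in Set.Ioi (0 : ℝ), ENNReal.ofReal (t ^ (-ν - 1) * exp (-b * t - r ^ 2 / (4 * t)))

/-- Follows from cosh t = 1 + 2 sinh²(t/2) and |sinh x| ≥ |x|. It provides a Gaussian majorant for
exp(-z cosh t), against which exp(νt) is harmless. -/
theorem half_sq_le_cosh (t : ℝ) : t ^ 2 / 2 ≤ cosh t := by
  have h := cosh_sq (t / 2)
  have h2 := cosh_two_mul (t / 2)
  have h3 : (t / 2) ^ 2 ≤ sinh (t / 2) ^ 2 := by
    rw [sq_le_sq]
    rcases le_total 0 (t / 2) with h0 | h0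
    · rw [abs_of_nonneg h0, abs_of_nonneg (sinh_nonneg_iff.2 h0)]
      exact self_le_sinh_iff.2 h0
    · rw [abs_of_nonpos h0, abs_of_nonpos (sinh_nonpos_iff.2 h0)]
      exact neg_le_neg (sinh_le_self_iff.2 h0)
  rw [show 2 * (t / 2) = t by ring] at h2
  nlinarith

theorem integrable_exp_neg_mul_cosh_mul_exp {z : ℝ} (hz : 0 < z) (ν : ℝ) :
    Integrable (fun t : ℝ => exp (-z * cosh t) * exp (ν * t)) := by
  have h := (integrable_cexp_quadratic (b := ((z / 2 : ℝ) : ℂ)) (by simpa using hz) (ν : ℂ) 0).norm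
  refine h.mono' (by fun_prop) (Filter.Eventually.of_forall fun t => ?_)
  have : (-((z / 2 : ℝ) : ℂ) * (t : ℂ) ^ 2 + (ν : ℂ) * t + 0) =
      ((-(z / 2) * t ^ 2 + ν * t : ℝ) : ℂ) := by push_cast; ring
  rw [this, Complex.norm_exp_ofReal, ← exp_add, norm_of_nonneg (exp_pos _).le, exp_le_exp]
  nlinarith [half_sq_le_cosh t]

theorem integral_exp_neg_mul_cosh_mul_exp {z : ℝ} (hz : 0 < z) (ν : ℝ) :
    ∫ t : ℝ, exp (-z * cosh t) * exp (ν * t) = 2 * besselK ν z := by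
  have hi := integrable_exp_neg_mul_cosh_mul_exp hz
  rw [← intervalIntegral.integral_Iic_add_Ioi (b := 0) (hi ν).integrableOn (hi ν).integrableOn]
  have h := integral_comp_neg_Ioi 0 (fun t : ℝ => exp (-z * cosh t) * exp (ν * t))
  rw [neg_zero] at h
  rw [← h, ← integral_add _ (hi ν).integrableOn, besselK, ← integral_const_mul]
  · refine setIntegral_congr_fun measurableSet_Ioi fun t _ => ?_
    simp only [cosh_eq (ν * t), cosh_neg]
    rw [show ν * -t = -(ν * t) by ring]
    ring
  · refine (hi (-ν)).integrableOn.congr (Filter.Eventually.of_forall fun t => ?_)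
    simp only [cosh_neg, mul_neg, neg_mul]

theorem image_const_mul_exp {c : ℝ} (hc : 0 < c) :
    (fun τ : ℝ => c * exp τ) '' Set.univ = Set.Ioi 0 := by
  ext x
  simp only [Set.image_univ, Set.mem_range, Set.mem_Ioi]
  constructor
  · rintro ⟨y, rfl⟩; positivity
  · intro hx
    exact ⟨log (x / c), by rw [exp_log (by positivity)]; field_simp⟩

/-- The substitution t = (r/2m) e^τ balances the exponent: m²t + r²/(4t) becomes mr cosh τ. The
remaining factor e^(-ντ) gives K_(-ν), which equals K_ν. -/
theorem subordinatedKernel_sq {m r : ℝ} (hm : 0 < m) (hr : 0 < r) (ν : ℝ) :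
    subordinatedKernel (m ^ 2) ν r = ENNReal.ofReal (2 * (2 * m / r) ^ ν * besselK ν (m * r)) := by
  set c := r / (2 * m) with hc
  have hc0 : 0 < c := by positivity
  have hmr : 0 < m * r := by positivity
  rw [subordinatedKernel, ← image_const_mul_exp hc0,
    lintegral_image_eq_lintegral_abs_deriv_mul (f' := fun τ => c * exp τ) MeasurableSet.univ
      (fun x _ => ((hasDerivAt_exp x).const_mul c).hasDerivWithinAt)
      (fun x _ y _ h => exp_injective (mul_left_cancel₀ hc0.ne' h)), setLIntegral_univ]
  have key : ∀ τ : ℝ, ENNReal.ofReal |c * exp τ| * ENNReal.ofReal ((c * exp τ) ^ (-ν - 1) *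
      exp (-m ^ 2 * (c * exp τ) - r ^ 2 / (4 * (c * exp τ)))) =
      ENNReal.ofReal ((2 * m / r) ^ ν * (exp (-(m * r) * cosh τ) * exp (-ν * τ))) := by
    intro τ
    have h0 : 0 < c * exp τ := by positivity
    rw [← ENNReal.ofReal_mul (abs_nonneg _), abs_of_pos h0, ← mul_assoc, rpow_sub_one h0.ne',
      mul_div_cancel₀ _ h0.ne', mul_rpow hc0.le (exp_pos _).le, ← exp_mul, rpow_neg hc0.le,
      ← inv_rpow hc0.le, hc, inv_div, cosh_eq, exp_neg τ]
    have hE := (exp_pos τ).ne'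
    rw [show -m ^ 2 * (r / (2 * m) * exp τ) - r ^ 2 / (4 * (r / (2 * m) * exp τ)) =
      -(m * r) * ((exp τ + (exp τ)⁻¹) / 2) by field_simp; ring, mul_comm (-ν) τ]
    congr 1
    ring
  simp_rw [key]
  rw [← ofReal_integral_eq_lintegral_ofReal, integral_const_mul,
    integral_exp_neg_mul_cosh_mul_exp hmr]
  · congr 1
    have : besselK (-ν) (m * r) = besselK ν (m * r) := by simp [besselK]
    rw [this]; ring
  · exact (integrable_exp_neg_mul_cosh_mul_exp hmr (-ν)).const_mul _
  · exact Filter.Eventually.of_forall fun t => by positivity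

/-- The substitution y = 1/t leaves a Gamma integral with rate r²/4. -/
theorem subordinatedKernel_zero {ν r : ℝ} (hν : 0 < ν) (hr : 0 < r) :
    subordinatedKernel 0 ν r = ENNReal.ofReal (4 ^ ν * Gamma ν / r ^ (2 * ν)) := by
  have hr4 : 0 < r ^ 2 / 4 := by positivity
  have h1 := integral_comp_rpow_Ioi (fun y : ℝ => y ^ (ν - 1) * exp (-(r ^ 2 / 4 * y)))
    (p := -1) (by norm_num)
  have hint : IntegrableOn (fun y : ℝ => y ^ (ν - 1) * exp (-(r ^ 2 / 4 * y))) (Set.Ioi 0) := by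
    have := integrableOn_rpow_mul_exp_neg_mul_rpow (p := 1) (s := ν - 1) (b := r ^ 2 / 4)
      (by linarith) (by norm_num) hr4
    refine this.congr_fun (fun x _ => by simp) measurableSet_Ioi
  have h2 := (integrableOn_Ioi_comp_rpow_iff (fun y : ℝ => y ^ (ν - 1) * exp (-(r ^ 2 / 4 * y)))
    (p := -1) (by norm_num)).2 hint
  rw [integral_rpow_mul_exp_neg_mul_Ioi hν hr4] at h1
  have key : Set.EqOn (fun x : ℝ => (|(-1 : ℝ)| * x ^ ((-1 : ℝ) - 1)) •
      ((x ^ (-1 : ℝ)) ^ (ν - 1) * exp (-(r ^ 2 / 4 * x ^ (-1 : ℝ)))))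
      (fun t => t ^ (-ν - 1) * exp (-0 * t - r ^ 2 / (4 * t))) (Set.Ioi 0) := by
    intro x hx
    have hx : 0 < x := hx
    simp only [abs_neg, abs_one, one_mul, smul_eq_mul]
    rw [← rpow_mul hx.le, ← mul_assoc, ← rpow_add hx, rpow_neg_one]
    congr 2
    · ring
    · field_simp; ring
  rw [setIntegral_congr_fun measurableSet_Ioi key] at h1
  rw [subordinatedKernel, ← ofReal_integral_eq_lintegral_ofReal, h1]
  · congr 1
    rw [one_div_div, div_rpow (by norm_num) (by positivity), ← rpow_natCast, ← rpow_mul hr.le]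
    push_cast; ring
  · exact h2.congr_fun key measurableSet_Ioi
  · refine (ae_restrict_mem measurableSet_Ioi).mono fun t (ht : 0 < t) => ?_
    simp only [Pi.zero_apply]; positivity

/-- Since e^(-bt)(1 - e^(-at)) = t ∫ e^(-xt) dx over b < x ≤ a + b, exchanging integrals leaves
Γ(1-s) x^(s-1) to integrate in x. The t-integral converges at 0 because s < 1, the x-integral (when
b = 0) because s > 0. -/
theorem lintegral_rpow_mul_exp_mul_one_sub_exp {s a b : ℝ} (hs₀ : 0 < s) (hs₁ : s < 1)
    (ha : 0 ≤ a) (hb : 0 ≤ b) :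
    ∫⁻ t in Set.Ioi (0 : ℝ), ENNReal.ofReal (t ^ (-s - 1) * exp (-b * t) * (1 - exp (-a * t))) =
      ENNReal.ofReal (Gamma (1 - s) / s * ((a + b) ^ s - b ^ s)) := by
  have hab : b ≤ a + b := by linarith
  have h1 : ∀ t ∈ Set.Ioi (0 : ℝ),
      ENNReal.ofReal (t ^ (-s - 1) * exp (-b * t) * (1 - exp (-a * t))) =
      ∫⁻ x in Set.Ioc b (a + b), ENNReal.ofReal (t ^ (-s) * exp (-(x * t))) := by
    intro t (ht : 0 < t)
    have hd : ∀ x : ℝ, HasDerivAt (fun x => -(t ^ (-s - 1) * exp (-(x * t))))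
        (t ^ (-s) * exp (-(x * t))) x := by
      intro x
      have := (((hasDerivAt_id x).mul_const t).neg.exp.const_mul (t ^ (-s - 1))).neg
      refine this.congr_deriv ?_
      have e : t ^ (-s) = t ^ (-s - 1) * t := by
        rw [← rpow_add_one ht.ne']; congr 1; ring
      simp only [id, Pi.neg_apply, e]; ring
    have hi : IntervalIntegrable (fun x => t ^ (-s) * exp (-(x * t))) volume b (a + b) :=
      Continuous.intervalIntegrable (by fun_prop) _ _
    have h := intervalIntegral.integral_eq_sub_of_hasDerivAt (fun x _ => hd x) hi
    rw [intervalIntegral.integral_of_le hab] at h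
    rw [← ofReal_integral_eq_lintegral_ofReal, h]
    · congr 1
      rw [show -((a + b) * t) = -b * t + -a * t by ring, exp_add, neg_mul b t]
      ring
    · exact (intervalIntegrable_iff_integrableOn_Ioc_of_le hab).1 hi
    · exact Filter.Eventually.of_forall fun x => by positivity
  rw [setLIntegral_congr_fun measurableSet_Ioi h1, lintegral_lintegral_swap]
  swap
  · exact Measurable.aemeasurable (by unfold Function.uncurry; fun_prop)
  have h2 : ∀ x ∈ Set.Ioc b (a + b),
      ∫⁻ t in Set.Ioi (0 : ℝ), ENNReal.ofReal (t ^ (-s) * exp (-(x * t))) =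
      ENNReal.ofReal (Gamma (1 - s) * x ^ (s - 1)) := by
    intro x hx
    have hx0 : 0 < x := lt_of_le_of_lt hb hx.1
    rw [← ofReal_integral_eq_lintegral_ofReal]
    · have := integral_rpow_mul_exp_neg_mul_Ioi (a := 1 - s) (r := x) (by linarith) hx0
      rw [show 1 - s - 1 = -s by ring] at this
      rw [this, one_div, inv_rpow hx0.le, ← rpow_neg hx0.le, mul_comm]
      congr 3; ring
    · have := integrableOn_rpow_mul_exp_neg_mul_rpow (p := 1) (s := -s) (b := x)
        (by linarith) (by norm_num) hx0
      exact this.congr_fun (fun x _ => by simp) measurableSet_Ioi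
    · refine (ae_restrict_mem measurableSet_Ioi).mono fun t (ht : 0 < t) => ?_
      simp only [Pi.zero_apply]; positivity
  rw [setLIntegral_congr_fun measurableSet_Ioc h2, ← ofReal_integral_eq_lintegral_ofReal]
  · congr 1
    rw [integral_const_mul, ← intervalIntegral.integral_of_le hab,
      integral_rpow (Or.inl (by linarith))]
    rw [show s - 1 + 1 = s by ring]; ring
  · refine Integrable.const_mul ?_ _
    exact (intervalIntegrable_iff_integrableOn_Ioc_of_le hab).1
      (intervalIntegral.intervalIntegrable_rpow' (by linarith))
  · refine (ae_restrict_mem measurableSet_Ioc).mono fun x hx => ?_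
    have hx0 : 0 < x := lt_of_le_of_lt hb hx.1
    have := Gamma_pos_of_pos (show 0 < 1 - s by linarith)
    simp only [Pi.zero_apply]; positivity

/-! ### Cosine integrals of Gaussians and the symbol of the kernel -/

section Gaussian

variable {V : Type*} [NormedAddCommGroup V] [InnerProductSpace ℝ V] [FiniteDimensional ℝ V]
  [MeasurableSpace V] [BorelSpace V]

theorem integrable_exp_neg_mul_norm_sq_mul_cos {b : ℝ} (hb : 0 < b) (ξ : V) :
    Integrable (fun h : V => exp (-b * ‖h‖ ^ 2) * cos (inner ℝ ξ h)) := by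
  have h := (GaussianFourier.integrable_cexp_neg_mul_sq_norm_add (V := V) (b := (b : ℂ))
    (by simpa using hb) Complex.I ξ).re
  refine h.congr (Filter.Eventually.of_forall fun x => ?_)
  simp [Complex.exp_re, ← Complex.ofReal_pow]

theorem integral_exp_neg_mul_norm_sq_mul_cos {b : ℝ} (hb : 0 < b) (ξ : V) :
    ∫ h : V, exp (-b * ‖h‖ ^ 2) * cos (inner ℝ ξ h) =
      (π / b) ^ ((Module.finrank ℝ V : ℝ) / 2) * exp (-‖ξ‖ ^ 2 / (4 * b)) := by
  have hi := GaussianFourier.integrable_cexp_neg_mul_sq_norm_add (V := V) (b := (b : ℂ))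
    (by simpa using hb) Complex.I ξ
  have h := congrArg Complex.re (GaussianFourier.integral_cexp_neg_mul_sq_norm_add (V := V)
    (b := (b : ℂ)) (by simpa using hb) Complex.I ξ)
  rw [show (∫ v : V, Complex.exp (-(b : ℂ) * ↑‖v‖ ^ 2 + Complex.I * ↑(inner ℝ ξ v))).re =
    ∫ v : V, (Complex.exp (-(b : ℂ) * ↑‖v‖ ^ 2 + Complex.I * ↑(inner ℝ ξ v))).re from
    (integral_re hi).symm] at h
  have e : ((π : ℂ) / b) ^ ((Module.finrank ℝ V : ℂ) / 2) *
      Complex.exp (Complex.I ^ 2 * (‖ξ‖ : ℂ) ^ 2 / (4 * b)) =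
      (((π / b) ^ ((Module.finrank ℝ V : ℝ) / 2) * exp (-‖ξ‖ ^ 2 / (4 * b)) : ℝ) : ℂ) := by
    rw [Complex.I_sq]
    push_cast
    rw [Complex.ofReal_cpow (by positivity)]
    push_cast
    congr 2
    ring
  rw [e, Complex.ofReal_re] at h
  rw [← h]
  congr 1 with x
  simp [Complex.exp_re, ← Complex.ofReal_pow]

theorem lintegral_one_sub_cos_mul_gaussian {t : ℝ} (ht : 0 < t) (ξ : V) :
    ∫⁻ h : V, ENNReal.ofReal ((1 - cos (inner ℝ ξ h)) * exp (-‖h‖ ^ 2 / (4 * t))) =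
      ENNReal.ofReal ((4 * π * t) ^ ((Module.finrank ℝ V : ℝ) / 2) * (1 - exp (-‖ξ‖ ^ 2 * t))) := by
  have hb : 0 < 1 / (4 * t) := by positivity
  have i0 := integrable_exp_neg_mul_norm_sq_mul_cos hb (0 : V)
  have i1 := integrable_exp_neg_mul_norm_sq_mul_cos hb ξ
  -- The constant term is the same cosine integral at frequency 0.
  have e : ∀ h : V, (1 - cos (inner ℝ ξ h)) * exp (-‖h‖ ^ 2 / (4 * t)) =
      exp (-(1 / (4 * t)) * ‖h‖ ^ 2) * cos (inner ℝ (0 : V) h) -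
      exp (-(1 / (4 * t)) * ‖h‖ ^ 2) * cos (inner ℝ ξ h) := by
    intro h
    rw [inner_zero_left, cos_zero,
      show -(1 / (4 * t)) * ‖h‖ ^ 2 = -‖h‖ ^ 2 / (4 * t) by ring]
    ring
  rw [← ofReal_integral_eq_lintegral_ofReal]
  · simp_rw [e]
    rw [integral_sub i0 i1, integral_exp_neg_mul_norm_sq_mul_cos hb,
      integral_exp_neg_mul_norm_sq_mul_cos hb]
    congr 1
    rw [show π / (1 / (4 * t)) = 4 * π * t by field_simp,
      show -‖ξ‖ ^ 2 / (4 * (1 / (4 * t))) = -‖ξ‖ ^ 2 * t by field_simp]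
    rw [norm_zero]
    norm_num
    ring
  · simp_rw [e]; exact i0.sub i1
  · exact Filter.Eventually.of_forall fun h =>
      mul_nonneg (sub_nonneg.2 (cos_le_one _)) (exp_pos _).le

theorem measurable_subordinatedKernel (b ν : ℝ) : Measurable (subordinatedKernel b ν) := by
  unfold subordinatedKernel
  apply Measurable.lintegral_prod_right' (f := fun p : ℝ × ℝ =>
    ENNReal.ofReal (p.2 ^ (-ν - 1) * exp (-b * p.2 - p.1 ^ 2 / (4 * p.2))))
  fun_prop

/-- A Lévy–Khintchine formula. The Gaussian of variance parameter t contributes (4πt)^(d/2); its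
power of t cancels the d/2 in the order of the kernel and leaves t^(-s-1). -/
theorem lintegral_one_sub_cos_mul_subordinatedKernel {s b : ℝ} (hs₀ : 0 < s) (hs₁ : s < 1)
    (hb : 0 ≤ b) (ξ : V) :
    ∫⁻ h : V, ENNReal.ofReal (1 - cos (inner ℝ ξ h)) *
        subordinatedKernel b ((Module.finrank ℝ V : ℝ) / 2 + s) ‖h‖ =
      ENNReal.ofReal ((4 * π) ^ ((Module.finrank ℝ V : ℝ) / 2) * (Gamma (1 - s) / s) *
        ((‖ξ‖ ^ 2 + b) ^ s - b ^ s)) := by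
  set d : ℝ := (Module.finrank ℝ V : ℝ) / 2
  have h1 : ∀ h : V, ENNReal.ofReal (1 - cos (inner ℝ ξ h)) * subordinatedKernel b (d + s) ‖h‖ =
      ∫⁻ t in Set.Ioi (0 : ℝ), ENNReal.ofReal (t ^ (-(d + s) - 1) * exp (-b * t)) *
        ENNReal.ofReal ((1 - cos (inner ℝ ξ h)) * exp (-‖h‖ ^ 2 / (4 * t))) := by
    intro h
    have hc : 0 ≤ 1 - cos (inner ℝ ξ h) := sub_nonneg.2 (cos_le_one _)
    rw [subordinatedKernel, ← lintegral_const_mul _ (by fun_prop)]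
    refine setLIntegral_congr_fun measurableSet_Ioi fun t (ht : 0 < t) => ?_
    rw [← ENNReal.ofReal_mul hc, ← ENNReal.ofReal_mul (by positivity), sub_eq_add_neg (-b * t),
      exp_add, neg_div]
    congr 1; ring
  simp_rw [h1]
  rw [lintegral_lintegral_swap]
  swap
  · exact Measurable.aemeasurable (by unfold Function.uncurry; fun_prop)
  have h2 : ∀ t ∈ Set.Ioi (0 : ℝ),
      ∫⁻ h : V, ENNReal.ofReal (t ^ (-(d + s) - 1) * exp (-b * t)) *
        ENNReal.ofReal ((1 - cos (inner ℝ ξ h)) * exp (-‖h‖ ^ 2 / (4 * t))) =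
      ENNReal.ofReal ((4 * π) ^ d) *
        ENNReal.ofReal (t ^ (-s - 1) * exp (-b * t) * (1 - exp (-‖ξ‖ ^ 2 * t))) := by
    intro t (ht : 0 < t)
    rw [lintegral_const_mul _ (by fun_prop), lintegral_one_sub_cos_mul_gaussian ht,
      ← ENNReal.ofReal_mul (by positivity), ← ENNReal.ofReal_mul (by positivity)]
    rw [mul_rpow (by positivity) ht.le]
    change ENNReal.ofReal (_ * ((4 * π) ^ d * t ^ d * _)) = _
    congr 1
    rw [show -s - 1 = (-(d + s) - 1) + d by ring, rpow_add ht]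
    ring
  rw [setLIntegral_congr_fun measurableSet_Ioi h2, lintegral_const_mul _ (by fun_prop),
    lintegral_rpow_mul_exp_mul_one_sub_exp hs₀ hs₁ (by positivity) hb,
    ← ENNReal.ofReal_mul (by positivity), mul_assoc]

end Gaussian

/-! ### Plancherel for differences of translates -/

section Translation

open FourierTransform

variable {V : Type*} [NormedAddCommGroup V] [InnerProductSpace ℝ V]

theorem enorm_sq_Lp_two {α : Type*} [MeasurableSpace α] {μ : Measure α} (f : Lp ℂ 2 μ) :
    ‖f‖ₑ ^ 2 = ∫⁻ x, ‖f x‖ₑ ^ 2 ∂μ := by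
  rw [Lp.enorm_def, eLpNorm_eq_lintegral_rpow_enorm_toReal (by norm_num) (by norm_num)]
  simp [← ENNReal.rpow_mul_natCast]

/-- The function `ξ ↦ exp (2πi⟨h, ξ⟩) - 1` as a bounded continuous function. -/
def translationSymbol (h : V) : BoundedContinuousFunction V ℂ :=
  BoundedContinuousFunction.ofNormedAddCommGroup
    (fun ξ => (Real.fourierChar (inner ℝ h ξ) : ℂ) - 1)
    (by fun_prop) 2 (fun ξ => (norm_sub_le _ _).trans (by
      rw [Circle.norm_coe, norm_one]; norm_num))

/-- This is |e^(iθ) - 1|² = 2(1 - cos θ). The 2π of the Fourier kernel is attached to ξ to match the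
frequency in the Lévy–Khintchine formula. -/
theorem enorm_translationSymbol_sq (h ξ : V) :
    ‖translationSymbol h ξ‖ₑ ^ 2 = ENNReal.ofReal (2 * (1 - cos (inner ℝ ((2 * π) • ξ) h))) := by
  rw [← ofReal_norm, ← ENNReal.ofReal_pow (norm_nonneg _)]
  congr 1
  change ‖(Real.fourierChar (inner ℝ h ξ) : ℂ) - 1‖ ^ 2 = _
  rw [Real.fourierChar_apply, ← Complex.normSq_eq_norm_sq, Complex.normSq_apply]
  simp only [Complex.sub_re, Complex.sub_im, Complex.exp_ofReal_mul_I_re,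
    Complex.exp_ofReal_mul_I_im, Complex.one_re, Complex.one_im]
  rw [real_inner_smul_left, real_inner_comm]
  nlinarith [sin_sq_add_cos_sq (2 * π * inner ℝ ξ h)]

variable [FiniteDimensional ℝ V] [MeasurableSpace V] [BorelSpace V]

theorem fourier_compSubConst_neg_sub (φ : 𝓢(V, ℂ)) (h ξ : V) :
    𝓕 (SchwartzMap.compSubConstCLM ℂ (-h) φ - φ) ξ = translationSymbol h ξ * 𝓕 φ ξ := by
  have h1 : 𝓕 (SchwartzMap.compSubConstCLM ℂ (-h) φ) ξ =
      Real.fourierChar (inner ℝ h ξ) • 𝓕 φ ξ := by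
    have := congrFun (VectorFourier.fourierIntegral_comp_add_right Real.fourierChar
      (volume : Measure V) (innerₗ V) (φ : V → ℂ) h) ξ
    rw [SchwartzMap.fourier_coe, SchwartzMap.fourier_coe]
    convert! this using 3
    ext x
    simp
  have h2 : 𝓕 (SchwartzMap.compSubConstCLM ℂ (-h) φ - φ) =
    𝓕 (SchwartzMap.compSubConstCLM ℂ (-h) φ) - 𝓕 φ := 
    (FourierTransform.fourierCLM ℂ 𝓢(V, ℂ)).map_sub _ _
  rw [h2, sub_apply, h1]
  change _ = ((Real.fourierChar (inner ℝ h ξ) : ℂ) - 1) * _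
  rw [Circle.smul_def, smul_eq_mul]
  ring

/-- For Schwartz functions the difference of translates is carried by 𝓕 to multiplication by
`translationSymbol h`, so Plancherel applies. Both L² norms are continuous in f, and Schwartz
functions are dense. -/
theorem lintegral_enorm_translate_sub_sq (f : Lp ℂ 2 (volume : Measure V)) (h : V) :
    ∫⁻ x, ‖f (x + h) - f x‖ₑ ^ 2 =
      ∫⁻ ξ, ENNReal.ofReal (2 * (1 - cos (inner ℝ ((2 * π) • ξ) h))) *
        ‖(𝓕 f : Lp ℂ 2 (volume : Measure V)) ξ‖ₑ ^ 2 := by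
  have hτ : MeasurePreserving (fun x : V => x + h) := measurePreserving_add_right volume h
  let A : Lp ℂ 2 (volume : Measure V) → Lp ℂ 2 (volume : Measure V) := fun f =>
    Lp.compMeasurePreservingₗᵢ ℂ _ hτ f - f
  let e : Lp ℂ ∞ (volume : Measure V) := ((translationSymbol h).memLp_top).toLp _
  let B : Lp ℂ 2 (volume : Measure V) → Lp ℂ 2 (volume : Measure V) := fun f =>
    (ContinuousLinearMap.mul ℂ ℂ).holderL volume ∞ 2 2 e (𝓕 f)
  have hA : ∀ f, (A f : V → ℂ) =ᵐ[volume] fun x => f (x + h) - f x := by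
    intro f
    filter_upwards [Lp.coeFn_sub (Lp.compMeasurePreservingₗᵢ ℂ _ hτ f) f,
      Lp.coeFn_compMeasurePreserving f hτ] with x h1 h2
    rw [h1, Pi.sub_apply]
    exact congrArg (· - f x) h2
  have hB : ∀ f, (B f : V → ℂ) =ᵐ[volume] fun ξ => translationSymbol h ξ *
      (𝓕 f : Lp ℂ 2 (volume : Measure V)) ξ := by
    intro f
    filter_upwards [ContinuousLinearMap.coeFn_holder (r := 2) (ContinuousLinearMap.mul ℂ ℂ) e
      (𝓕 f : Lp ℂ 2 (volume : Measure V)), ((translationSymbol h).memLp_top).coeFn_toLp]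
      with x h1 h2
    change (ContinuousLinearMap.holder 2 (ContinuousLinearMap.mul ℂ ℂ) e
      (𝓕 f : Lp ℂ 2 (volume : Measure V))) x = _
    rw [h1, h2]
    rfl
  have hAB : ‖A f‖ = ‖B f‖ := by
    refine DenseRange.induction_on (p := fun f => ‖A f‖ = ‖B f‖)
      (SchwartzMap.denseRange_toLpCLM (p := 2) (F := ℂ) (E := V) (μ := volume)
        ENNReal.ofNat_ne_top) f ?_ ?_
    · apply isClosed_eq
      · exact (((Lp.compMeasurePreservingₗᵢ ℂ _ hτ).continuous).sub continuous_id).norm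
      · exact (((ContinuousLinearMap.mul ℂ ℂ).holderL volume ∞ 2 2 e).continuous.comp
          (Lp.fourierTransformₗᵢ V ℂ).continuous).norm
    · intro φ
      have e1 : A (φ.toLp 2) = (SchwartzMap.compSubConstCLM ℂ (-h) φ - φ).toLp 2 := by
        apply Lp.ext
        filter_upwards [hA (φ.toLp 2), φ.coeFn_toLp 2 volume,
          hτ.quasiMeasurePreserving.ae (φ.coeFn_toLp 2 volume),
          (SchwartzMap.compSubConstCLM ℂ (-h) φ - φ).coeFn_toLp 2 volume] with x h1 h2 h3 h4
        rw [h1, h2, h3, h4]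
        simp
      have e2 : B (φ.toLp 2) = (𝓕 (SchwartzMap.compSubConstCLM ℂ (-h) φ - φ)).toLp 2 := by
        apply Lp.ext
        filter_upwards [hB (φ.toLp 2), (𝓕 φ).coeFn_toLp 2 volume,
          (𝓕 (SchwartzMap.compSubConstCLM ℂ (-h) φ - φ)).coeFn_toLp 2 volume] with x h1 h2 h3
        rw [h1, h3, fourier_compSubConst_neg_sub, SchwartzMap.toLp_fourier_eq, h2]
      simp only [SchwartzMap.toLpCLM_apply]
      rw [e1, e2, ← SchwartzMap.toLp_fourier_eq, Lp.norm_fourier_eq]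
  have h2 : ‖A f‖ₑ ^ 2 = ‖B f‖ₑ ^ 2 := by rw [← ofReal_norm, hAB, ofReal_norm]
  rw [enorm_sq_Lp_two, enorm_sq_Lp_two] at h2
  calc ∫⁻ x, ‖f (x + h) - f x‖ₑ ^ 2 = ∫⁻ x, ‖A f x‖ₑ ^ 2 :=
        lintegral_congr_ae ((hA f).mono fun x hx => by simp only [hx])
    _ = ∫⁻ ξ, ‖B f ξ‖ₑ ^ 2 := h2
    _ = _ := lintegral_congr_ae ((hB f).mono fun ξ hξ => by
        simp only [hξ]
        rw [enorm_mul, mul_pow, enorm_translationSymbol_sq])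

/-- Plancherel form of a translation-invariant Dirichlet form. -/
theorem lintegral_enorm_sub_sq_mul_kernel {g : V → ℂ} (hg : Measurable g)
    (f : Lp ℂ 2 (volume : Measure V)) (hfg : f =ᵐ[volume] g) {k : ℝ → ℝ≥0∞} (hk : Measurable k) :
    ∫⁻ p : V × V, ‖g p.1 - g p.2‖ₑ ^ 2 * k ‖p.1 - p.2‖ =
      2 * ∫⁻ ξ, (∫⁻ h : V, ENNReal.ofReal (1 - cos (inner ℝ ((2 * π) • ξ) h)) * k ‖h‖) *
        ‖(𝓕 f : Lp ℂ 2 (volume : Measure V)) ξ‖ₑ ^ 2 := by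
  have hf : Measurable ((𝓕 f : Lp ℂ 2 (volume : Measure V)) : V → ℂ) :=
    (Lp.stronglyMeasurable _).measurable
  rw [Measure.volume_eq_prod, lintegral_prod_symm _ (by fun_prop)]
  -- For fixed y, substitute x = y + h, so that the kernel depends on h alone.
  have h1 : ∀ y : V, ∫⁻ x, ‖g (x, y).1 - g (x, y).2‖ₑ ^ 2 * k ‖(x, y).1 - (x, y).2‖ =
      ∫⁻ h, ‖g (y + h) - g y‖ₑ ^ 2 * k ‖h‖ := by
    intro y
    rw [← lintegral_add_left_eq_self _ y]
    simp
  simp_rw [h1]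
  rw [lintegral_lintegral_swap (by unfold Function.uncurry; fun_prop)]
  have h2 : ∀ h : V, ∫⁻ y, ‖g (y + h) - g y‖ₑ ^ 2 * k ‖h‖ =
      ∫⁻ ξ, 2 * (ENNReal.ofReal (1 - cos (inner ℝ ((2 * π) • ξ) h)) * k ‖h‖ *
        ‖(𝓕 f : Lp ℂ 2 (volume : Measure V)) ξ‖ₑ ^ 2) := by
    intro h
    rw [lintegral_mul_const _ (by fun_prop)]
    -- The Borel representative g serves for Tonelli, the class f for Plancherel; translation
    -- preserves null sets, so they may be exchanged.
    have h3 : ∫⁻ y, ‖g (y + h) - g y‖ₑ ^ 2 = ∫⁻ y, ‖f (y + h) - f y‖ₑ ^ 2 := by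
      refine lintegral_congr_ae ?_
      filter_upwards [hfg,
        (measurePreserving_add_right volume h).quasiMeasurePreserving.ae hfg] with x h1 h2
      rw [h1, h2]
    rw [h3, lintegral_enorm_translate_sub_sq, ← lintegral_mul_const _ (by fun_prop)]
    refine lintegral_congr fun ξ => ?_
    rw [ENNReal.ofReal_mul (by norm_num), ENNReal.ofReal_ofNat]
    ring
  simp_rw [h2]
  rw [lintegral_lintegral_swap (by unfold Function.uncurry; fun_prop),
    ← lintegral_const_mul _ (by fun_prop)]
  refine lintegral_congr fun ξ => ?_
  rw [lintegral_const_mul _ (by fun_prop), lintegral_mul_const _ (by fun_prop)]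

end Translation

/-! ### Symbols and multiplication in L² -/

section Multiplier

open FourierTransform TemperedDistribution

variable {V : Type*} [NormedAddCommGroup V] [InnerProductSpace ℝ V]

/-- Up to the factor (m²)^σ, the symbol is a dilate of (1 + |ξ|²)^σ; this uses m ≠ 0. -/
theorem hasTemperateGrowth_relativisticSymbol {m : ℝ} (hm : 0 < m) (σ : ℝ) :
    (fun ξ : V => ((((2 * π * ‖ξ‖) ^ 2 + m ^ 2) ^ σ : ℝ) : ℂ)).HasTemperateGrowth := by
  have h1 := (Function.hasTemperateGrowth_one_add_norm_sq_rpow V σ).comp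
    (((2 * π / m) • ContinuousLinearMap.id ℝ V).hasTemperateGrowth)
  have h2 := Function.HasTemperateGrowth.comp Function.Complex.hasTemperateGrowth_ofReal
    ((Function.HasTemperateGrowth.const (E := V) ((m ^ 2) ^ σ)).mul h1)
  refine (congrArg Function.HasTemperateGrowth (funext fun ξ => ?_)).mp h2
  change (((m ^ 2) ^ σ * (1 + ‖(2 * π / m) • ξ‖ ^ 2) ^ σ : ℝ) : ℂ) = _
  rw [← mul_rpow (by positivity) (by positivity), norm_smul, norm_of_nonneg (by positivity)]
  congr 2
  field_simp
  ring

variable [FiniteDimensional ℝ V] [MeasurableSpace V] [BorelSpace V]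

/-- If `g` is a symbol with bounded inverse `g'` and `g • U` is represented by the
square-integrable function `W`, then `W = g * U` almost everywhere. -/
theorem ae_eq_mul_of_smulLeftCLM_eq {g g' : V → ℂ} (hg : g.HasTemperateGrowth)
    (hg' : g'.HasTemperateGrowth) (hgg' : ∀ ξ, g ξ * g' ξ = 1) (hb : ∃ C, ∀ ξ, ‖g' ξ‖ ≤ C)
    {U W : Lp ℂ 2 (volume : Measure V)} (h : smulLeftCLM ℂ g (U : 𝓢'(V, ℂ)) = (W : 𝓢'(V, ℂ))) :
    W =ᵐ[volume] fun ξ => g ξ * U ξ := by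
  obtain ⟨C, hC⟩ := hb
  have hg'm : MemLp g' ∞ (volume : Measure V) :=
    memLp_top_of_bound hg'.1.continuous.aestronglyMeasurable C (Filter.Eventually.of_forall hC)
  -- As g may be unbounded, the product is not formed from U in L²; instead the bounded inverse g'
  -- is applied to W, which recovers U.
  have h1 : ((hg'm.toLp g' • W : Lp ℂ 2 (volume : Measure V)) : 𝓢'(V, ℂ)) = (U : 𝓢'(V, ℂ)) := by
    rw [Lp.toTemperedDistribution_smul_eq hg', ← h, smulLeftCLM_smulLeftCLM_apply hg hg',
      show g * g' = fun _ => 1 from funext hgg', smulLeftCLM_const, one_smul]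
  have h2 : (hg'm.toLp g' • W : Lp ℂ 2 (volume : Measure V)) = U :=
    LinearMap.ker_eq_bot.1 (Lp.ker_toTemperedDistributionCLM_eq_bot (E := V) (F := ℂ)
      (μ := volume) (p := 2)) h1
  filter_upwards [Lp.coeFn_lpSMul (hg'm.toLp g') W (r := 2), hg'm.coeFn_toLp] with ξ h3 h4
  rw [h2, Pi.smul_apply', h4, smul_eq_mul] at h3
  rw [h3, ← mul_assoc, hgg', one_mul]

end Multiplier

/-! ### The relativistic operator and its energy -/

section Relativistic

open FourierTransform TemperedDistribution

variable {N : ℕ}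

/-- The symbol is (1 + |ξ|²)^(s/2), which maps the Sobolev space to L², times a quotient bounded by
((2π)² + m²)^(s/2). -/
theorem exists_relativisticPow_eq {s m : ℝ} (hs : 0 < s) (hm : 0 < m)
    {f : 𝓢'(EuclideanSpace ℝ (Fin N), ℂ)} (hf : MemSobolev s 2 f) :
    ∃ w : Lp ℂ 2 (volume : Measure (EuclideanSpace ℝ (Fin N))),
      relativisticPow N m (s / 2) f = (w : 𝓢'(EuclideanSpace ℝ (Fin N), ℂ)) := by
  rw [← memSobolev_zero_iff]
  have hj : (fun ξ : EuclideanSpace ℝ (Fin N) =>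
      (((1 + ‖ξ‖ ^ 2) ^ (s / 2) : ℝ) : ℂ)).HasTemperateGrowth := by fun_prop
  have hj' : (fun ξ : EuclideanSpace ℝ (Fin N) =>
      (((1 + ‖ξ‖ ^ 2) ^ (-(s / 2)) : ℝ) : ℂ)).HasTemperateGrowth := by fun_prop
  have hg := hasTemperateGrowth_relativisticSymbol (V := EuclideanSpace ℝ (Fin N)) hm (s / 2)
  have hb : MemSobolev 0 2 (besselPotential (EuclideanSpace ℝ (Fin N)) ℂ s f) := by
    rw [memSobolev_besselPotential_iff, add_zero]; exact hf
  have hq : MemSobolev 0 2 (fourierMultiplierCLM ℂ _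
      (besselPotential (EuclideanSpace ℝ (Fin N)) ℂ s f)) :=
    hb.fourierMultiplierCLM_of_bounded (hj'.mul hg)
    ⟨((2 * π) ^ 2 + m ^ 2) ^ (s / 2), fun ξ => ?_⟩
  · convert hq using 1
    rw [besselPotential, fourierMultiplierCLM_fourierMultiplierCLM_apply hj (hj'.mul hg),
      relativisticPow]
    congr 2
    ext ξ
    simp only [Pi.mul_apply]
    rw [← mul_assoc, ← Complex.ofReal_mul (_ ^ _), ← rpow_add (by positivity), add_neg_cancel,
      rpow_zero, Complex.ofReal_one, one_mul]
  · simp only [Pi.mul_apply]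
    rw [← Complex.ofReal_mul, Complex.norm_real, norm_of_nonneg (by positivity),
      rpow_neg (by positivity), ← inv_rpow (by positivity),
      ← mul_rpow (by positivity) (by positivity)]
    refine rpow_le_rpow (by positivity) ?_ (by positivity)
    rw [inv_mul_le_iff₀ (by positivity)]
    nlinarith [sq_nonneg (2 * π), sq_nonneg (m * ‖ξ‖)]

theorem fourier_ae_eq_of_relativisticPow_eq {σ m : ℝ} (hσ : 0 ≤ σ) (hm : 0 < m)
    {U w : Lp ℂ 2 (volume : Measure (EuclideanSpace ℝ (Fin N)))}
    (h : relativisticPow N m σ (U : 𝓢'(EuclideanSpace ℝ (Fin N), ℂ)) =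
      (w : 𝓢'(EuclideanSpace ℝ (Fin N), ℂ))) :
    (𝓕 w : Lp ℂ 2 (volume : Measure (EuclideanSpace ℝ (Fin N)))) =ᵐ[volume] fun ξ =>
      ((((2 * π * ‖ξ‖) ^ 2 + m ^ 2) ^ σ : ℝ) : ℂ) *
        (𝓕 U : Lp ℂ 2 (volume : Measure (EuclideanSpace ℝ (Fin N)))) ξ := by
  have hg := hasTemperateGrowth_relativisticSymbol (V := EuclideanSpace ℝ (Fin N)) hm
  refine ae_eq_mul_of_smulLeftCLM_eq (hg σ) (hg (-σ)) (fun ξ => ?_)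
    ⟨(m ^ 2) ^ (-σ), fun ξ => ?_⟩ ?_
  · rw [← Complex.ofReal_mul, ← rpow_add (by positivity), add_neg_cancel, rpow_zero,
      Complex.ofReal_one]
  · rw [Complex.norm_real, norm_of_nonneg (by positivity)]
    exact rpow_le_rpow_of_nonpos (by positivity) (by nlinarith [sq_nonneg (2 * π * ‖ξ‖)])
      (by linarith)
  · rw [← Lp.fourier_toTemperedDistribution_eq, ← Lp.fourier_toTemperedDistribution_eq, ← h,
      relativisticPow, fourierMultiplierCLM_apply, fourier_fourierInv_eq]

theorem integrable_norm_sq_Lp_two {α : Type*} [MeasurableSpace α] {μ : Measure α}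
    (f : Lp ℂ 2 μ) : Integrable (fun x => ‖f x‖ ^ 2) μ :=
  (memLp_two_iff_integrable_sq_norm (Lp.aestronglyMeasurable f)).1 (Lp.memLp f)

theorem integral_norm_sq_Lp_two {α : Type*} [MeasurableSpace α] {μ : Measure α}
    (f : Lp ℂ 2 μ) : ∫ x, ‖f x‖ ^ 2 ∂μ = ‖f‖ ^ 2 := by
  rw [integral_eq_lintegral_of_nonneg_ae (Filter.Eventually.of_forall fun x => by positivity)
    (integrable_norm_sq_Lp_two f).1]
  have := enorm_sq_Lp_two f
  simp_rw [← ofReal_norm, ← ENNReal.ofReal_pow (norm_nonneg _)] at this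
  rw [← this, ENNReal.toReal_ofReal (by positivity)]

theorem measurable_besselK (ν : ℝ) : Measurable (besselK ν) := by
  have : StronglyMeasurable (Function.uncurry fun r t : ℝ => exp (-r * cosh t) * cosh (ν * t)) := by
    apply Measurable.stronglyMeasurable
    unfold Function.uncurry
    fun_prop
  exact (this.integral_prod_right (ν := volume.restrict (Set.Ioi 0))).measurable

theorem besselK_nonneg (ν r : ℝ) : 0 ≤ besselK ν r :=
  integral_nonneg fun _ => mul_nonneg (exp_pos _).le (cosh_pos _).le

theorem relativisticIntegrand_nonneg (m s : ℝ) (u : EuclideanSpace ℝ (Fin N) → ℝ)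
    (p : EuclideanSpace ℝ (Fin N) × EuclideanSpace ℝ (Fin N)) :
    0 ≤ relativisticIntegrand m s u p :=
  mul_nonneg (by positivity) (besselK_nonneg _ _)

theorem measurable_relativisticIntegrand (m s : ℝ) {u : EuclideanSpace ℝ (Fin N) → ℝ}
    (hu : Measurable u) : Measurable (relativisticIntegrand m s u) := by
  unfold relativisticIntegrand
  have := measurable_besselK (((N : ℝ) + 2 * s) / 2)
  fun_prop

theorem relativisticIntegrand_ae_congr (m s : ℝ) {u u' : EuclideanSpace ℝ (Fin N) → ℝ}
    (h : u =ᵐ[volume] u') : relativisticIntegrand m s u =ᵐ[volume] relativisticIntegrand m s u' := by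
  rw [Measure.volume_eq_prod]
  filter_upwards [Measure.quasiMeasurePreserving_fst.ae h,
    Measure.quasiMeasurePreserving_snd.ae h] with p h1 h2
  rw [relativisticIntegrand, relativisticIntegrand, h1, h2]

/-- The identity holds at every point: on the diagonal the squared difference vanishes, so both
sides are 0 whatever the kernel is there. -/
theorem enorm_sub_sq_mul_subordinatedKernel {m : ℝ} (hm : 0 < m) (s : ℝ)
    (u : EuclideanSpace ℝ (Fin N) → ℝ)
    (p : EuclideanSpace ℝ (Fin N) × EuclideanSpace ℝ (Fin N)) :
    ‖(u p.1 : ℂ) - u p.2‖ₑ ^ 2 * subordinatedKernel (m ^ 2) ((N : ℝ) / 2 + s) ‖p.1 - p.2‖ =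
      ENNReal.ofReal (2 * (2 * m) ^ (((N : ℝ) + 2 * s) / 2)) *
        ENNReal.ofReal (relativisticIntegrand m s u p) := by
  rw [show (N : ℝ) / 2 + s = ((N : ℝ) + 2 * s) / 2 by ring]
  rcases eq_or_ne p.1 p.2 with h | h
  · simp [relativisticIntegrand, h]
  · have hr : 0 < ‖p.1 - p.2‖ := norm_pos_iff.2 (sub_ne_zero.2 h)
    rw [subordinatedKernel_sq hm hr, ← ofReal_norm, ← ENNReal.ofReal_pow (norm_nonneg _),
      ← ENNReal.ofReal_mul (by positivity), ← ENNReal.ofReal_mul (by positivity),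
      ← Complex.ofReal_sub, Complex.norm_real, norm_eq_abs, sq_abs, relativisticIntegrand,
      div_rpow (by positivity) hr.le]
    congr 1
    ring

/-- The energy identity up to the value of the constant. -/
theorem relativistic_energy {s m : ℝ} (hs₀ : 0 < s) (hs₁ : s < 1) (hm : 0 < m)
    {u : EuclideanSpace ℝ (Fin N) → ℝ}
    {U w : Lp ℂ 2 (volume : Measure (EuclideanSpace ℝ (Fin N)))}
    (hU : U =ᵐ[volume] fun x => (u x : ℂ))
    (h : relativisticPow N m (s / 2) (U : 𝓢'(EuclideanSpace ℝ (Fin N), ℂ)) =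
      (w : 𝓢'(EuclideanSpace ℝ (Fin N), ℂ))) (hu : AEMeasurable u) :
    Integrable (relativisticIntegrand m s u) ∧
      (2 * (2 * m) ^ (((N : ℝ) + 2 * s) / 2)) * ∫ p, relativisticIntegrand m s u p =
        2 * ((4 * π) ^ ((N : ℝ) / 2) * (Gamma (1 - s) / s)) *
          ∫ x, (‖w x‖ ^ 2 - m ^ (2 * s) * u x ^ 2) := by
  set u' := hu.mk u
  have hu'm : Measurable u' := hu.measurable_mk
  have huu' : u =ᵐ[volume] u' := hu.ae_eq_mk
  have hcongr := relativisticIntegrand_ae_congr m s huu'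
  set D := 2 * (2 * m) ^ (((N : ℝ) + 2 * s) / 2)
  set C := (4 * π) ^ ((N : ℝ) / 2) * (Gamma (1 - s) / s)
  have hΓ : 0 < Gamma (1 - s) := Gamma_pos_of_pos (by linarith)
  have hC0 : 0 < C := by positivity
  have hD0 : 0 < D := by positivity
  have hm2 : (m ^ 2) ^ s = m ^ (2 * s) := by
    rw [← rpow_natCast, ← rpow_mul hm.le, Nat.cast_ofNat]
  have hF := fourier_ae_eq_of_relativisticPow_eq (by positivity) hm h
  have hE := lintegral_enorm_sub_sq_mul_kernel (g := fun x => (u' x : ℂ)) (by fun_prop) U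
    (hU.trans (huu'.mono fun x hx => by simp only [hx]))
    (measurable_subordinatedKernel (m ^ 2) ((N : ℝ) / 2 + s))
  simp_rw [enorm_sub_sq_mul_subordinatedKernel hm] at hE
  have hL := fun ξ : EuclideanSpace ℝ (Fin N) =>
    lintegral_one_sub_cos_mul_subordinatedKernel hs₀ hs₁ (sq_nonneg m) ((2 * π) • ξ)
  rw [finrank_euclideanSpace_fin] at hL
  simp_rw [hL] at hE
  have hsymb : ∀ ξ : EuclideanSpace ℝ (Fin N),
      0 ≤ (‖(2 * π) • ξ‖ ^ 2 + m ^ 2) ^ s - (m ^ 2) ^ s := fun ξ =>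
    sub_nonneg.2 (rpow_le_rpow (by positivity) (by nlinarith [sq_nonneg ‖(2 * π) • ξ‖]) hs₀.le)
  -- Because |ŵ|² = ((2π|ξ|)² + m²)^s |Û|², the weighted integrand is a difference of two integrable
  -- functions, which makes the right side finite.
  have hae : (fun ξ => ENNReal.ofReal (C * ((‖(2 * π) • ξ‖ ^ 2 + m ^ 2) ^ s - (m ^ 2) ^ s)) *
      ‖(FourierTransform.fourier U : Lp ℂ 2 (volume : Measure (EuclideanSpace ℝ (Fin N)))) ξ‖ₑ ^ 2)
      =ᵐ[volume] fun ξ => ENNReal.ofReal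
      (C * (‖(𝓕 w : Lp ℂ 2 (volume : Measure (EuclideanSpace ℝ (Fin N)))) ξ‖ ^ 2 -
        m ^ (2 * s) * ‖(𝓕 U : Lp ℂ 2 (volume : Measure (EuclideanSpace ℝ (Fin N)))) ξ‖ ^ 2)) := by
    filter_upwards [hF] with ξ hξ
    rw [← ofReal_norm, ← ENNReal.ofReal_pow (norm_nonneg _),
      ← ENNReal.ofReal_mul (mul_nonneg hC0.le (hsymb ξ)), hξ, norm_mul, Complex.norm_real,
      norm_of_nonneg (by positivity), mul_pow, ← rpow_mul_natCast (by positivity), norm_smul,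
      norm_of_nonneg (show 0 ≤ 2 * π by positivity), hm2]
    congr 1
    push_cast
    rw [div_mul_cancel₀ s two_ne_zero]
    ring
  have hnonneg : ∀ᵐ ξ : EuclideanSpace ℝ (Fin N), 0 ≤
      C * (‖(𝓕 w : Lp ℂ 2 (volume : Measure (EuclideanSpace ℝ (Fin N)))) ξ‖ ^ 2 -
        m ^ (2 * s) * ‖(𝓕 U : Lp ℂ 2 (volume : Measure (EuclideanSpace ℝ (Fin N)))) ξ‖ ^ 2) := by
    filter_upwards [hF] with ξ hξ
    have e := hsymb ξ
    rw [hξ, norm_mul, Complex.norm_real, norm_of_nonneg (by positivity), mul_pow,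
      ← rpow_mul_natCast (by positivity)]
    push_cast
    rw [div_mul_cancel₀ s two_ne_zero, ← sub_mul]
    rw [norm_smul, norm_of_nonneg (show 0 ≤ 2 * π by positivity), hm2] at e
    exact mul_nonneg hC0.le (mul_nonneg e (sq_nonneg _))
  have hint : Integrable (fun ξ : EuclideanSpace ℝ (Fin N) =>
      C * (‖(𝓕 w : Lp ℂ 2 (volume : Measure (EuclideanSpace ℝ (Fin N)))) ξ‖ ^ 2 -
        m ^ (2 * s) * ‖(𝓕 U : Lp ℂ 2 (volume : Measure (EuclideanSpace ℝ (Fin N)))) ξ‖ ^ 2)) :=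
    ((integrable_norm_sq_Lp_two _).sub ((integrable_norm_sq_Lp_two _).const_mul _)).const_mul _
  have hR : ∫ ξ : EuclideanSpace ℝ (Fin N),
      C * (‖(𝓕 w : Lp ℂ 2 (volume : Measure (EuclideanSpace ℝ (Fin N)))) ξ‖ ^ 2 -
        m ^ (2 * s) * ‖(𝓕 U : Lp ℂ 2 (volume : Measure (EuclideanSpace ℝ (Fin N)))) ξ‖ ^ 2) =
      C * ∫ x, (‖w x‖ ^ 2 - m ^ (2 * s) * u x ^ 2) := by
    have e : ∫ x, (‖w x‖ ^ 2 - m ^ (2 * s) * u x ^ 2) =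
        ∫ x, (‖w x‖ ^ 2 - m ^ (2 * s) * ‖U x‖ ^ 2) := by
      refine integral_congr_ae ?_
      filter_upwards [hU] with x hx
      rw [hx, Complex.norm_real, norm_eq_abs, sq_abs]
    rw [e, integral_const_mul, integral_sub (integrable_norm_sq_Lp_two _)
      ((integrable_norm_sq_Lp_two _).const_mul _), integral_sub (integrable_norm_sq_Lp_two _)
      ((integrable_norm_sq_Lp_two _).const_mul _)]
    simp only [integral_const_mul, integral_norm_sq_Lp_two, Lp.norm_fourier_eq]
  have hmeas := measurable_relativisticIntegrand m s hu'm
  rw [lintegral_congr_ae hae, ← ofReal_integral_eq_lintegral_ofReal hint hnonneg, hR,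
    lintegral_const_mul _ (by fun_prop)] at hE
  have hR0 : 0 ≤ C * ∫ x, (‖w x‖ ^ 2 - m ^ (2 * s) * u x ^ 2) :=
    hR ▸ integral_nonneg_of_ae hnonneg
  have hI : Integrable (relativisticIntegrand m s u') := by
    refine ⟨hmeas.aestronglyMeasurable, ?_⟩
    rw [hasFiniteIntegral_iff_ofReal
      (Filter.Eventually.of_forall (relativisticIntegrand_nonneg m s u'))]
    -- An infinite double integral would contradict the finite right side of `hE`.
    refine lt_of_le_of_ne le_top fun htop => ?_
    rw [htop, ENNReal.mul_top (ENNReal.ofReal_pos.2 hD0).ne'] at hE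
    exact ENNReal.mul_ne_top (by norm_num) ENNReal.ofReal_ne_top hE.symm
  refine ⟨hI.congr hcongr.symm, ?_⟩
  rw [integral_congr_ae hcongr]
  have h2 : ∀ x : ℝ, 2 * ENNReal.ofReal x = ENNReal.ofReal (2 * x) := fun x => by
    rw [ENNReal.ofReal_mul (by norm_num), ENNReal.ofReal_ofNat]
  rw [← ofReal_integral_eq_lintegral_ofReal hI
    (Filter.Eventually.of_forall (relativisticIntegrand_nonneg m s u')),
    ← ENNReal.ofReal_mul hD0.le, h2,
    ENNReal.ofReal_eq_ofReal_iff
      (mul_nonneg hD0.le (integral_nonneg (relativisticIntegrand_nonneg m s u')))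
      (mul_nonneg (by norm_num) hR0)] at hE
  rw [hE, mul_assoc 2 C]

/-! ### The integral defining the constant -/

theorem cosineKernel_nonneg [NeZero N] (s : ℝ) (ξ : EuclideanSpace ℝ (Fin N)) :
    0 ≤ cosineKernel N s ξ :=
  div_nonneg (sub_nonneg.2 (cos_le_one _)) (by positivity)

/-- This is the Lévy–Khintchine formula with b = 0 at the first basis vector, where (1 + 0)^s - 0^s
= 1. -/
theorem integral_cosineKernel [NeZero N] {s : ℝ} (hs₀ : 0 < s) (hs₁ : s < 1) :
    Integrable (cosineKernel N s) ∧
      4 ^ (((N : ℝ) + 2 * s) / 2) * Gamma (((N : ℝ) + 2 * s) / 2) * ∫ ξ, cosineKernel N s ξ =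
        (4 * π) ^ ((N : ℝ) / 2) * (Gamma (1 - s) / s) := by
  have hν : 0 < ((N : ℝ) + 2 * s) / 2 := by positivity
  have hΓν := Gamma_pos_of_pos hν
  have hΓ : 0 < Gamma (1 - s) := Gamma_pos_of_pos (by linarith)
  have hL := lintegral_one_sub_cos_mul_subordinatedKernel hs₀ hs₁ le_rfl
    (EuclideanSpace.single (0 : Fin N) (1 : ℝ))
  have e : ∀ h : EuclideanSpace ℝ (Fin N),
      ENNReal.ofReal (1 - cos (inner ℝ (EuclideanSpace.single (0 : Fin N) (1 : ℝ)) h)) *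
        subordinatedKernel 0 ((N : ℝ) / 2 + s) ‖h‖ =
      ENNReal.ofReal (4 ^ (((N : ℝ) + 2 * s) / 2) * Gamma (((N : ℝ) + 2 * s) / 2)) *
        ENNReal.ofReal (cosineKernel N s h) := by
    intro h
    rw [show (N : ℝ) / 2 + s = ((N : ℝ) + 2 * s) / 2 by ring]
    rcases eq_or_ne h 0 with rfl | hh
    · simp [cosineKernel]
    · rw [subordinatedKernel_zero hν (norm_pos_iff.2 hh),
        ← ENNReal.ofReal_mul (sub_nonneg.2 (cos_le_one _)), ← ENNReal.ofReal_mul (by positivity),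
        cosineKernel, EuclideanSpace.inner_single_left,
        show 2 * (((N : ℝ) + 2 * s) / 2) = (N : ℝ) + 2 * s by ring]
      simp only [map_one, one_mul]
      congr 1
      ring
  have hm : Measurable (cosineKernel N s) := by
    unfold cosineKernel
    fun_prop
  rw [finrank_euclideanSpace_fin] at hL
  simp_rw [e] at hL
  rw [lintegral_const_mul _ (by fun_prop), PiLp.norm_single] at hL
  norm_num [zero_rpow hs₀.ne'] at hL
  have hI : Integrable (cosineKernel N s) := by
    refine ⟨hm.aestronglyMeasurable, ?_⟩
    rw [hasFiniteIntegral_iff_ofReal (Filter.Eventually.of_forall (cosineKernel_nonneg s))]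
    refine lt_of_le_of_ne le_top fun htop => ?_
    rw [htop, ENNReal.mul_top (by simp only [ne_eq, ENNReal.ofReal_eq_zero, not_le]; positivity)]
      at hL
    exact ENNReal.ofReal_ne_top hL.symm
  refine ⟨hI, ?_⟩
  rwa [← ofReal_integral_eq_lintegral_ofReal hI
    (Filter.Eventually.of_forall (cosineKernel_nonneg s)), ← ENNReal.ofReal_mul (by positivity),
    ENNReal.ofReal_eq_ofReal_iff
      (mul_nonneg (by positivity) (integral_nonneg (cosineKernel_nonneg s)))
      (by positivity)] at hL

end Relativistic

end

/-! ### Assembly of the constants -/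

theorem mainTheorem9 (N : ℕ) [NeZero N] (s : ℝ) (hs₀ : 0 < s) (hs₁ : s < 1) (m : ℝ) (hm : 0 < m) :
    (Integrable (cosineKernel N s) volume ∧
      relativisticConst N s =
        (2 : ℝ) ^ (-(((N : ℝ) + 2 * s) / 2) + 1) / Gamma (((N : ℝ) + 2 * s) / 2) *
          (π ^ (-((N : ℝ) / 2)) * (2 : ℝ) ^ (2 * s) *
            (Gamma (((N : ℝ) + 2 * s) / 2) / Gamma (2 - s)) * s * (1 - s))) ∧
    ∀ (u : EuclideanSpace ℝ (Fin N) → ℝ) (hu : MemLp u 2 volume),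
      TemperedDistribution.MemSobolev s 2 (l2Distribution u hu) →
      ∃ w : Lp ℂ 2 (volume : Measure (EuclideanSpace ℝ (Fin N))),
        relativisticPow N m (s / 2) (l2Distribution u hu) = (w : 𝓢'(EuclideanSpace ℝ (Fin N), ℂ)) ∧
        Integrable (relativisticIntegrand m s u) volume ∧
        ∫ x, (‖w x‖ ^ 2 - m ^ (2 * s) * u x ^ 2) =
          relativisticConst N s / 2 * m ^ (((N : ℝ) + 2 * s) / 2) *
            ∫ p, relativisticIntegrand m s u p := by
  obtain ⟨hI, hJ⟩ := integral_cosineKernel (N := N) hs₀ hs₁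
  have hν : 0 < ((N : ℝ) + 2 * s) / 2 := by positivity
  have hΓν := Gamma_pos_of_pos hν
  have hΓ : 0 < Gamma (1 - s) := Gamma_pos_of_pos (by linarith)
  -- Two splittings of 4^ν, ν = (N + 2s)/2: this one matches the factor (2m)^ν of the energy
  -- identity, `h4s` cancels (4π)^(N/2) in the closed form.
  have h4 : (4 : ℝ) ^ (((N : ℝ) + 2 * s) / 2) =
      2 ^ (((N : ℝ) + 2 * s) / 2) * 2 ^ (((N : ℝ) + 2 * s) / 2) := by
    rw [← mul_rpow (by norm_num) (by norm_num)]; norm_num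
  have h4s : (4 : ℝ) ^ (((N : ℝ) + 2 * s) / 2) = 4 ^ ((N : ℝ) / 2) * 2 ^ (2 * s) := by
    rw [show ((N : ℝ) + 2 * s) / 2 = (N : ℝ) / 2 + s by ring, rpow_add (by norm_num),
      rpow_mul (by norm_num)]
    norm_num
  have hJ' : ∫ ξ, cosineKernel N s ξ = (4 * π) ^ ((N : ℝ) / 2) * (Gamma (1 - s) / s) /
      (4 ^ (((N : ℝ) + 2 * s) / 2) * Gamma (((N : ℝ) + 2 * s) / 2)) := by
    rw [eq_div_iff (by positivity), ← hJ]; ring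
  refine ⟨⟨hI, ?_⟩, fun u hu hS => ?_⟩
  · have h2s : Gamma (2 - s) = (1 - s) * Gamma (1 - s) := by
      rw [← Gamma_add_one (by linarith : 1 - s ≠ 0)]; congr 1; ring
    have h1s : 0 < 1 - s := by linarith
    rw [relativisticConst, hJ', h2s, h4s, mul_rpow (by norm_num) (by positivity),
      rpow_neg pi_pos.le]
    congr 1
    field_simp
  · obtain ⟨w, hw⟩ := exists_relativisticPow_eq hs₀ hm hS
    obtain ⟨h1, h2⟩ := relativistic_energy (u := u) hs₀ hs₁ hm (hu.ofReal (K := ℂ)).coeFn_toLp hw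
      hu.1.aemeasurable
    refine ⟨w, hw, h1, ?_⟩
    rw [relativisticConst, hJ', h4, rpow_add (by norm_num), rpow_neg (by norm_num), rpow_one]
    rw [mul_rpow (by norm_num) hm.le] at h2
    set K := ∫ p, relativisticIntegrand m s u p
    set R := ∫ x, (‖w x‖ ^ 2 - m ^ (2 * s) * u x ^ 2)
    have hC : 0 < (4 * π) ^ ((N : ℝ) / 2) * (Gamma (1 - s) / s) := by positivity
    -- The energy and the cosine integral share this factor, so only its positivity matters.
    generalize (4 * π) ^ ((N : ℝ) / 2) * (Gamma (1 - s) / s) = C at h2 hC ⊢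
    have hR : R = 2 ^ (((N : ℝ) + 2 * s) / 2) * m ^ (((N : ℝ) + 2 * s) / 2) * K / C := by
      rw [eq_div_iff hC.ne']; linarith
    rw [hR]
    field_simp
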